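/- All complexes are finite abstract simplicial complexes that contain the empty set as a face, and $\dim\sigma=|\sigma|-1$. A complex is pure if all its facets (inclusion-maximal faces) have the same dimension. For an integer $r\ge 2$ let $E=E_1\sqcup\dots\sqcup E_r$ be a disjoint union of $r$ blocks with $|E_i|=r$ for every $i$, and let $M_r$ be the matroid on $E$, regarded as the simplicial complex of its independent sets, given by $$M_r=\{I\subseteq E:\ |I|\le r,\ |I\cap E_i|\le 1 \text{ for } i=1,\dots,r-1\},$$ that is, the $(r-1)$-skeleton of $U_{1,r}(E_1)\oplus\dots\oplus U_{1,r}(E_{r-1})\oplus U_{r,r}(E_r)$, where $U_{m,n}(S)$ denotes the uniform matroid of rank $m$ on a set $S$ with $n$ elements. The $2$-fold deleted join of $M_r$ is the complex $$(M_r)^{*2}_\Delta=\{\sigma_1\sqcup\sigma_2:\ \sigma_1,\sigma_2\in M_r,\ \sigma_1\cap\sigma_2=\emptyset\}$$ on the vertex set $E\sqcup E$. A shelling (in the sense of Björner and Wachs) of a possibly non-pure complex $\Sigma$ is a strict linear order $\ll$ on the set of its facets such that, for every facet $B$ for which there is a facet $A\ll B$, the complex $$B\cap\Big(\bigcup_{A\ll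 B}A\Big)$$ (each facet being regarded as the complex of all its subsets) is pure of dimension $\dim B-1$; $\Sigma$ is shellable if it has a shelling. **Proposition.** Let $r\ge 3$ be an integer. Then the $2$-fold deleted join $(M_r)^{*2}_\Delta$ of $M_r$ is not pure, and it is shellable. -/

import Mathlib

/-- An abstract simplicial complex with vertices in `V`, with the convention that the empty set is
always a face (of dimension `-1`). Mathlib's `PreAbstractSimplicialComplex` leaves the empty face
out, which does not fit joins and shellings. Not every element of `V` has to be a vertex. -/
@[ext]
structure AbsComplex (V : Type*) where
  faces : Set (Finset V)
  empty_mem : ∅ ∈ faces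
  down_closed : ∀ {s t : Finset V}, s ∈ faces → t ⊆ s → t ∈ faces

namespace AbsComplex

/-- The dimension of a face: one less than its number of vertices. -/
def dim {V : Type*} (s : Finset V) : ℤ := (s.card : ℤ) - 1

/-- The facets of `K`: the faces that are not contained in any other face. -/
def IsFacet {V : Type*} (K : AbsComplex V) (s : Finset V) : Prop :=
  Maximal (fun t => t ∈ K.faces) s

/-- `K` is pure: all its facets have the same dimension. -/
def IsPure {V : Type*} (K : AbsComplex V) : Prop :=
  ∀ s t : Finset V, K.IsFacet s → K.IsFacet t → dim s = dim t

/-- `K` is pure and `d`-dimensional: it has a facet, and each of its facets has dimension `d`. -/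
def IsPureOfDim {V : Type*} (K : AbsComplex V) (d : ℤ) : Prop :=
  (∃ s, K.IsFacet s) ∧ ∀ s, K.IsFacet s → dim s = d

/-- The complex `B ∩ (⋃_{A ∈ 𝒜} A)`, where each of the faces `B` and `A ∈ 𝒜` is regarded as the
complex of all its subsets. (If `𝒜` is empty, this is the complex `{∅}`.) -/
def interUnion {V : Type*} (B : Finset V) (𝒜 : Set (Finset V)) : AbsComplex V where
  faces := {s | s ⊆ B ∧ (s = ∅ ∨ ∃ A ∈ 𝒜, s ⊆ A)}
  empty_mem := ⟨Finset.empty_subset _, Or.inl rfl⟩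
  down_closed := by
    rintro s t ⟨hB, h⟩ hts
    refine ⟨hts.trans hB, ?_⟩
    rcases h with rfl | ⟨A, hA, hsA⟩
    · exact Or.inl (Finset.subset_empty.mp hts)
    · exact Or.inr ⟨A, hA, hts.trans hsA⟩

/-- A (possibly non-pure) shelling of a finite complex `K`, in the sense of Björner and Wachs:
a strict linear order `≪` on the facets of `K` such that for each facet `B` that has a prior
facet, the intersection of `B` with the union of all prior facets is a pure complex of
dimension `dim B - 1`. -/
structure IsShelling {V : Type*} [Finite V] (K : AbsComplex V)
    (lt : {s : Finset V // K.IsFacet s} → {s : Finset V // K.IsFacet s} → Prop) : Prop where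
  strictTotalOrder : IsStrictTotalOrder {s : Finset V // K.IsFacet s} lt
  pure_inter : ∀ B, (∃ A, lt A B) →
    (interUnion B.1 {A | ∃ A', lt A' B ∧ A'.1 = A}).IsPureOfDim (dim B.1 - 1)

/-- `K` is shellable: it has a shelling. -/
def IsShellable {V : Type*} [Finite V] (K : AbsComplex V) : Prop :=
  ∃ lt, K.IsShelling lt

/-- The part of `s ⊆ ι × V` in the `i`-th copy of `V`. -/
noncomputable def slice {ι V : Type*} (i : ι) (s : Finset (ι × V)) : Finset V :=
  s.preimage (Prod.mk i) (Prod.mk_right_injective i).injOn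

/-- The join of a family of complexes, on the disjoint union `ι × V` of copies of the vertex set:
a set is a face iff its part in each copy `i` is a face of `K i`. For matroids, regarded as the
complexes of their independent sets, this is the direct sum. -/
def join {ι V : Type*} (K : ι → AbsComplex V) : AbsComplex (ι × V) where
  faces := {s | ∀ i, slice i s ∈ (K i).faces}
  empty_mem := fun i => by simpa [slice] using (K i).empty_mem
  down_closed := fun {s t} hs hts i => (K i).down_closed (hs i) (by
    intro v hv
    simp only [slice, Finset.mem_preimage] at hv ⊢
    exact hts hv)

/-- The `k`-fold deleted join of `K`: the faces `σ₁ ⊔ ⋯ ⊔ σₖ` of the `k`-fold join of `K` such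
that `σ₁, …, σₖ` are pairwise disjoint as subsets of `V`. -/
def deletedJoin {V : Type*} (k : ℕ) (K : AbsComplex V) : AbsComplex (Fin k × V) where
  faces := {s | s ∈ (join (fun _ : Fin k => K)).faces ∧
    ∀ i j, i ≠ j → Disjoint (slice i s) (slice j s)}
  empty_mem := ⟨(join (fun _ : Fin k => K)).empty_mem, fun i j _ => by simp [slice]⟩
  down_closed := fun {s t} hs hts =>
    ⟨(join (fun _ : Fin k => K)).down_closed hs.1 hts, fun i j hij => by
      have h := hs.2 i j hij
      rw [Finset.disjoint_left] at h ⊢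
      intro v hi hj
      simp only [slice, Finset.mem_preimage] at h hi hj
      exact h (hts hi) (hts hj)⟩

/-- The `d`-skeleton of `K`: the faces of dimension at most `d`, for `d ≥ -1`. -/
def skeleton {V : Type*} (K : AbsComplex V) (d : ℤ) (hd : -1 ≤ d) : AbsComplex V where
  faces := {s | s ∈ K.faces ∧ dim s ≤ d}
  empty_mem := ⟨K.empty_mem, by simpa [dim] using hd⟩
  down_closed := fun {s t} hs hts => ⟨K.down_closed hs.1 hts, by
    have h := hs.2
    have := Finset.card_le_card hts
    simp only [dim] at h ⊢
    omega⟩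

/-- The uniform matroid of rank `m` on the ground set `E`, as a complex: all subsets of `E` with
at most `m` elements. -/
def uniform (m : ℕ) (E : Type*) : AbsComplex E where
  faces := {s | s.card ≤ m}
  empty_mem := by simp
  down_closed := fun hs hts => (Finset.card_le_card hts).trans hs

/-- The direct sum `U_{1,r}(E₁) ⊕ ⋯ ⊕ U_{1,r}(E_{r-1}) ⊕ U_{r,r}(E_r)` on the ground set
`E₁ ⊔ ⋯ ⊔ E_r = Fin r × Fin r`. The pair `(i, j)`, counted from `0`, is the `j`-th element of
the `i`-th block; the last block is the one with `i + 1 = r`. -/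
def matroidHat (r : ℕ) : AbsComplex (Fin r × Fin r) :=
  join (fun i : Fin r => uniform (if (i : ℕ) + 1 = r then r else 1) (Fin r))

/-- The matroid `M_r`, as the complex of its independent sets: the `(r-1)`-skeleton of
`matroidHat r`, that is, the faces of `matroidHat r` with at most `r` elements. -/
def matroidM (r : ℕ) : AbsComplex (Fin r × Fin r) :=
  (matroidHat r).skeleton ((r : ℤ) - 1) (by omega)

end AbsComplex

/-!
A face of the deleted join of `M_r` is a partial colouring of `E` with two colours, in which each
colour is used at most `r` times, and at most once in each block other than the last one. A facet
either uses both colours `r` times, or one colour fills the last block and the other one has exactly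
one element in each of the other blocks. Since the facets of the second kind have only `2r - 1`
elements, the complex is not pure (`not_isPure_deletedJoin_matroidM`).

For the shelling, the facets are ordered by a lexicographic key (`key`): first those with `2r`
elements; among facets of equal size, those with the smaller sum of block indices; among these,
those with the smaller sum of weights. By the criterion `isShellable_of_exchange` it suffices
that, for distinct facets `F`, `G` with `key G ≤ key F`, some `x ∈ F \ G` can be traded so that the
key drops (`canExchange_of_isFacet`).

Let `F` have `2r` elements. If some colour is distributed differently over the blocks in `F` and in
`G`, an element of `F \ G` can be moved to a block with a smaller index
(`canExchange_of_card_block_ne`). If the distributions agree, but a colour has at least two elements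
in the last block and differs there, then this colour misses another block, and an element can be
moved to that one. Otherwise `F` and `G` differ only in blocks in which the colours that differ have
one element each, and the claim reduces to shelling the bipartite chessboard graph on `r + r`
vertices (`exists_block_exchange`); here `3 ≤ r` is needed.

Let `F` have `2r - 1` elements. If an element of the last block does not have the full colour of `F`
in `G`, recolouring it leads to a larger face (`exists_larger_face_of_full`). Otherwise `G` is of the
same kind as `F`, and again an exchange inside a block applies.
-/

namespace AbsComplex

/-! ### A criterion for shellability -/

theorem exists_isFacet_superset {V : Type*} [Finite V] (K : AbsComplex V) {s : Finset V}
    (hs : s ∈ K.faces) : ∃ t, s ⊆ t ∧ K.IsFacet t :=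
  Finite.exists_le_maximal (p := fun t => t ∈ K.faces) hs

/-- An exchange criterion for shellability. The facets are ordered by a key `κ` that drops when a
face is enlarged; ties are broken arbitrarily, which is why the exchange is required already for
`κ G ≤ κ F`. It suffices to exchange a vertex `x ∈ F \ G` so as to reach some face `C` with a
smaller key, because any facet containing `C` has a key at most that of `C`. -/
theorem isShellable_of_exchange {V : Type*} [Finite V] [DecidableEq V] (K : AbsComplex V)
    {L : Type*} [LinearOrder L] (κ : Finset V → L)
    (hanti : ∀ s t, t ∈ K.faces → s ⊂ t → κ t < κ s)
    (hex : ∀ F G, K.IsFacet F → K.IsFacet G → F ≠ G → κ G ≤ κ F →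
      ∃ x ∈ F, x ∉ G ∧ ∃ C ∈ K.faces, F.erase x ⊆ C ∧ x ∉ C ∧ κ C < κ F) :
    K.IsShellable := by
  classical
  obtain ⟨n, ⟨e⟩⟩ := Finite.exists_equiv_fin {s : Finset V // K.IsFacet s}
  let f : {s : Finset V // K.IsFacet s} → L ×ₗ Fin n := fun A => toLex (κ A.1, e A)
  have hf : Function.Injective f := by
    intro A B h
    have := congrArg (fun z => (ofLex z).2) h
    exact e.injective this
  refine ⟨fun A B => f A < f B, ?_, ?_⟩
  · exact
      { irrefl := fun A => lt_irrefl (f A)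
        trans := fun A B C => lt_trans
        trichotomous := fun A B h₁ h₂ => hf (le_antisymm (not_lt.mp h₂) (not_lt.mp h₁)) }
  · rintro ⟨B, hB⟩ ⟨A₀, hA₀⟩
    set I := interUnion B {A | ∃ A', f A' < f ⟨B, hB⟩ ∧ A'.1 = A} with hI
    have key : ∀ A : {s : Finset V // K.IsFacet s}, f A < f ⟨B, hB⟩ →
        ∃ x ∈ B, x ∉ A.1 ∧ B.erase x ∈ I.faces := by
      rintro ⟨A, hA⟩ hlt
      have hle : κ A ≤ κ B := by
        rcases Prod.Lex.lt_iff.mp hlt with h | h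
        · exact le_of_lt h
        · exact le_of_eq h.1
      have hne : B ≠ A := by
        rintro rfl
        exact lt_irrefl _ hlt
      obtain ⟨x, hxB, hxA, C, hC, hsub, hxC, hκ⟩ := hex B A hB hA hne hle
      obtain ⟨D, hCD, hD⟩ := K.exists_isFacet_superset hC
      have hκD : κ D < κ B := by
        rcases eq_or_ssubset_of_subset hCD with h | h
        · exact h ▸ hκ
        · exact (hanti C D hD.1 h).trans hκ
      exact ⟨x, hxB, hxA, Finset.erase_subset _ _, Or.inr ⟨D, ⟨⟨D, hD⟩,
        Prod.Lex.lt_iff.mpr (Or.inl hκD), rfl⟩, hsub.trans hCD⟩⟩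
    refine ⟨?_, ?_⟩
    · obtain ⟨t, -, ht⟩ := I.exists_isFacet_superset I.empty_mem
      exact ⟨t, ht⟩
    · intro s hs
      have hcov : ∃ A : {s : Finset V // K.IsFacet s}, f A < f ⟨B, hB⟩ ∧ s ⊆ A.1 := by
        rcases hs.1.2 with h | ⟨A, ⟨A', hA', rfl⟩, hsA⟩
        · exact ⟨A₀, hA₀, by simp [h]⟩
        · exact ⟨A', hA', hsA⟩
      obtain ⟨A, hA, hsA⟩ := hcov
      obtain ⟨x, hxB, hxA, hx⟩ := key A hA
      have hsub : s ⊆ B.erase x := fun v hv =>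
        Finset.mem_erase.mpr ⟨fun h => hxA (h ▸ hsA hv), hs.1.1 hv⟩
      have heq : s = B.erase x := le_antisymm hsub (hs.2 hx hsub)
      have h1 := Finset.card_erase_add_one hxB
      simp only [dim, heq]
      omega

/-! ### Numerical and single-block exchanges -/

/-- Two distinct distributions of the same number of tokens: if the mean position in `g` is at
most that in `f`, then `f` exceeds `g` at some position, and falls short of it at a smaller one. -/
theorem exists_lt_of_sum_mul_le {r : ℕ} (f g : Fin r → ℕ) (hsum : ∑ i, f i = ∑ i, g i)
    (hle : ∑ i : Fin r, (i : ℕ) * g i ≤ ∑ i : Fin r, (i : ℕ) * f i) (hne : f ≠ g) :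
    ∃ i j, j < i ∧ g i < f i ∧ f j < g j := by
  by_contra! hcon
  have hover : ∃ i, g i < f i := by
    by_contra! h
    exact hne (funext fun i => (Finset.sum_eq_sum_iff_of_le fun i _ => h i).mp hsum i (by simp))
  have hunder : ∃ j, f j < g j := by
    by_contra! h
    exact hne (funext fun i =>
      ((Finset.sum_eq_sum_iff_of_le fun i _ => h i).mp hsum.symm i (by simp)).symm)
  obtain ⟨t, ht, hmax⟩ := (Finset.univ.filter fun i => g i < f i).exists_max_image id
    (by obtain ⟨i, hi⟩ := hover; exact ⟨i, by simpa using hi⟩)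
  simp only [Finset.mem_filter, Finset.mem_univ, true_and, id] at ht hmax
  have hz : ∑ i : Fin r, ((i : ℤ) - t) * ((f i : ℤ) - g i) < ∑ i : Fin r, (0 : ℤ) := by
    have hsign : ∀ j, f j < g j → ((j : ℤ) - t) * ((f j : ℤ) - g j) < 0 := by
      intro j hj
      have h1 : ¬ j < t := fun h => absurd (hcon t j h ht) (by omega)
      have h2 : j ≠ t := by rintro rfl; omega
      have h3 : (t : ℕ) < j := lt_of_le_of_ne (not_lt.mp h1) (fun h => h2 (Fin.ext h.symm))
      exact mul_neg_of_pos_of_neg (by omega) (by omega)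
    obtain ⟨j, hj⟩ := hunder
    refine Finset.sum_lt_sum (fun i _ => ?_) ⟨j, Finset.mem_univ _, hsign j hj⟩
    rcases lt_trichotomy (f i) (g i) with h | h | h
    · exact (hsign i h).le
    · simp [h]
    · have : (i : ℕ) ≤ t := hmax i h
      exact mul_nonpos_of_nonpos_of_nonneg (by omega) (by omega)
  have hexp : ∑ i : Fin r, ((i : ℤ) - t) * ((f i : ℤ) - g i)
      = ((∑ i : Fin r, (i : ℕ) * f i : ℕ) : ℤ) - ((∑ i : Fin r, (i : ℕ) * g i : ℕ) : ℤ)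
        - t * (((∑ i, f i : ℕ) : ℤ) - ((∑ i, g i : ℕ) : ℤ)) := by
    push_cast
    rw [← Finset.sum_sub_distrib, ← Finset.sum_sub_distrib, Finset.mul_sum,
      ← Finset.sum_sub_distrib]
    exact Finset.sum_congr rfl fun i _ => by ring
  rw [hexp, hsum, Finset.sum_const_zero] at hz
  simp only [sub_self, mul_zero, sub_zero] at hz
  omega

/-- The exchange inside one block, in which `A`, `B` are the sets of elements used by the two
colours. For two singletons this says that ordering the edges `(a, b)`, `a ≠ b`, of the bipartite
chessboard graph by increasing `a` and then by decreasing `b` is a shelling; this needs `3 ≤ r`. -/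
theorem exists_block_exchange {r : ℕ} (hr : 3 ≤ r) {A B A' B' : Finset (Fin r)}
    (hAB : Disjoint A B) (hAB' : Disjoint A' B') (hA : A.card = A'.card) (hB : B.card = B'.card)
    (hA1 : A = A' ∨ A.card ≤ 1) (hB1 : B = B' ∨ B.card ≤ 1) (hne : ¬ (A = A' ∧ B = B'))
    (hle : ∑ e ∈ A', (e : ℕ) * r + ∑ e ∈ B', (r - 1 - (e : ℕ)) ≤
      ∑ e ∈ A, (e : ℕ) * r + ∑ e ∈ B, (r - 1 - (e : ℕ))) :
    (∃ x ∈ A, x ∉ A' ∧ ∃ y, y ∉ A ∧ y ∉ B ∧ y < x) ∨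
      (∃ x ∈ B, x ∉ B' ∧ ∃ y, y ∉ A ∧ y ∉ B ∧ x < y) := by
  have single : ∀ S T : Finset (Fin r), S.card = T.card → (S = T ∨ S.card ≤ 1) → S ≠ T →
      ∃ a b, S = {a} ∧ T = {b} ∧ a ≠ b := by
    intro S T hc h1 hST
    have h2 : S.card ≤ 1 := h1.resolve_left hST
    have h3 : S.card ≠ 0 := fun h => hST (by
      rw [Finset.card_eq_zero.mp h, Finset.card_eq_zero.mp (hc.symm.trans h)])
    obtain ⟨a, rfl⟩ := Finset.card_eq_one.mp (show S.card = 1 by omega)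
    obtain ⟨b, rfl⟩ := Finset.card_eq_one.mp hc.symm
    exact ⟨a, b, rfl, rfl, fun h => hST (by rw [h])⟩
  by_cases hAA : A = A'
  · subst hAA
    obtain ⟨b, b', rfl, rfl, hbb⟩ := single B B' hB hB1 (fun h => hne ⟨rfl, h⟩)
    simp only [Finset.sum_singleton] at hle
    have hlt : b < b' := by
      have : (b : ℕ) ≠ b' := fun h => hbb (Fin.ext h)
      rw [Fin.lt_def]; omega
    exact Or.inr ⟨b, by simp, by simpa using hbb, b', by simpa using hAB',
      by simpa using hbb.symm, hlt⟩
  obtain ⟨a, a', rfl, rfl, haa⟩ := single A A' hA hA1 hAA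
  have haa' : (a : ℕ) ≠ a' := fun h => haa (Fin.ext h)
  by_cases hBB : B = B'
  · subst hBB
    simp only [Finset.sum_singleton] at hle
    have hlt : a' < a := by
      rw [Fin.lt_def]
      by_contra hcon
      have : (a : ℕ) + 1 ≤ a' := by omega
      have := Nat.mul_le_mul_right r this
      rw [add_mul] at this
      omega
    exact Or.inl ⟨a, by simp, by simpa using haa, a', by simpa using haa.symm,
      by simpa using hAB', hlt⟩
  obtain ⟨b, b', rfl, rfl, hbb⟩ := single B B' hB hB1 hBB
  simp only [Finset.sum_singleton] at hle
  have hab : (a : ℕ) ≠ b := fun h => by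
    have : a = b := Fin.ext h
    simp [this] at hAB
  have hlt : (a' : ℕ) < a := by
    by_contra hcon
    have : (a : ℕ) + 1 ≤ a' := by omega
    have := Nat.mul_le_mul_right r this
    rw [add_mul] at this
    omega
  by_cases h1 : a' = b
  · subst h1
    by_cases h2 : 2 ≤ (a : ℕ)
    · -- One of `0`, `1` differs from `b`, and both are smaller than `a`.
      by_cases h3 : (a' : ℕ) = 0
      · refine Or.inl ⟨a, by simp, by simpa using haa, ⟨1, by omega⟩, ?_, ?_, ?_⟩
        · simp only [Finset.mem_singleton, Fin.ext_iff]; omega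
        · simp only [Finset.mem_singleton, Fin.ext_iff]; omega
        · rw [Fin.lt_def]; simp; omega
      · refine Or.inl ⟨a, by simp, by simpa using haa, ⟨0, by omega⟩, ?_, ?_, ?_⟩
        · simp only [Finset.mem_singleton, Fin.ext_iff]; omega
        · simp only [Finset.mem_singleton, Fin.ext_iff]; omega
        · rw [Fin.lt_def]; simp; omega
    · -- Here `a = 1` and `b = 0`, so that only `b` can be moved.
      refine Or.inr ⟨a', by simp, by simpa using hbb, ⟨2, by omega⟩, ?_, ?_, ?_⟩
      · simp only [Finset.mem_singleton, Fin.ext_iff]; omega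
      · simp only [Finset.mem_singleton, Fin.ext_iff]; omega
      · rw [Fin.lt_def]; simp; omega
  · exact Or.inl ⟨a, by simp, by simpa using haa, a', by simpa using haa.symm, by simpa using h1,
      hlt⟩

/-! ### Faces and facets of the deleted join -/

theorem mem_slice {ι V : Type*} {i : ι} {s : Finset (ι × V)} {v : V} :
    v ∈ slice i s ↔ (i, v) ∈ s := by
  simp [slice]

theorem sum_eq_sum_slice {ι V : Type*} [Fintype ι] (s : Finset (ι × V)) (f : ι × V → ℕ) :
    ∑ v ∈ s, f v = ∑ i, ∑ v ∈ slice i s, f (i, v) :=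
  Finset.sum_finset_product s Finset.univ (fun i => slice i s) (by simp [mem_slice])

theorem card_eq_sum_card_slice {ι V : Type*} [Fintype ι] (s : Finset (ι × V)) :
    s.card = ∑ i, (slice i s).card := by
  simpa using sum_eq_sum_slice s (fun _ => 1)

/-- The elements of the block `i` that `s` uses in the colour `c`, that is, in its part in the
`c`-th copy of the ground set. -/
noncomputable def block {r : ℕ} (c : Fin 2) (i : Fin r) (s : Finset (Fin 2 × Fin r × Fin r)) :
    Finset (Fin r) :=
  slice i (slice c s)

theorem mem_block {r : ℕ} {c : Fin 2} {i e : Fin r} {s : Finset (Fin 2 × Fin r × Fin r)} :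
    e ∈ block c i s ↔ (c, i, e) ∈ s := by
  simp [block, mem_slice]

theorem card_slice_eq_sum_block {r : ℕ} (c : Fin 2) (s : Finset (Fin 2 × Fin r × Fin r)) :
    (slice c s).card = ∑ i, (block c i s).card :=
  card_eq_sum_card_slice _

theorem block_mono {r : ℕ} {c : Fin 2} {i : Fin r} {s t : Finset (Fin 2 × Fin r × Fin r)}
    (h : s ⊆ t) : block c i s ⊆ block c i t := fun _ he => mem_block.mpr (h (mem_block.mp he))

theorem mem_deletedJoin_matroidM {r : ℕ} {s : Finset (Fin 2 × Fin r × Fin r)} :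
    s ∈ (deletedJoin 2 (matroidM r)).faces ↔
      (∀ c, (slice c s).card ≤ r) ∧
      (∀ c (i : Fin r), (i : ℕ) + 1 ≠ r → (block c i s).card ≤ 1) ∧
      ∀ c c' i, c ≠ c' → Disjoint (block c i s) (block c' i s) := by
  have h1 : s ∈ (deletedJoin 2 (matroidM r)).faces ↔
      (∀ c, (∀ i : Fin r, (block c i s).card ≤ if (i : ℕ) + 1 = r then r else 1) ∧
        dim (slice c s) ≤ (r : ℤ) - 1) ∧
      ∀ c c', c ≠ c' → Disjoint (slice c s) (slice c' s) := Iff.rfl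
  rw [h1]
  constructor
  · rintro ⟨h2, h3⟩
    refine ⟨fun c => ?_, fun c i hi => ?_, fun c c' i hcc => ?_⟩
    · have := (h2 c).2
      simp only [dim] at this
      omega
    · have := (h2 c).1 i
      rwa [if_neg hi] at this
    · have := h3 c c' hcc
      rw [Finset.disjoint_left] at this ⊢
      intro e he he'
      exact this (mem_slice.mp he) (mem_slice.mp he')
  · rintro ⟨h2, h3, h4⟩
    refine ⟨fun c => ⟨fun i => ?_, ?_⟩, fun c c' hcc => ?_⟩
    · split_ifs with hi
      · simpa using Finset.card_le_univ (block c i s)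
      · exact h3 c i hi
    · have := h2 c
      simp only [dim]
      omega
    · rw [Finset.disjoint_left]
      rintro ⟨i, e⟩ he he'
      exact Finset.disjoint_left.mp (h4 c c' i hcc) (mem_slice.mpr he) (mem_slice.mpr he')

theorem card_le_of_mem {r : ℕ} {s : Finset (Fin 2 × Fin r × Fin r)}
    (hs : s ∈ (deletedJoin 2 (matroidM r)).faces) : s.card ≤ 2 * r := by
  have h := (mem_deletedJoin_matroidM.mp hs).1
  rw [card_eq_sum_card_slice, Fin.sum_univ_two]
  have := h 0
  have := h 1
  omega

/-- Adding an element that neither colour uses. -/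
theorem insert_mem {r : ℕ} {s : Finset (Fin 2 × Fin r × Fin r)}
    (hs : s ∈ (deletedJoin 2 (matroidM r)).faces) {c : Fin 2} {j e : Fin r}
    (hc : (slice c s).card < r) (hj : (j : ℕ) + 1 = r ∨ block c j s = ∅)
    (he : ∀ c', e ∉ block c' j s) :
    insert (c, j, e) s ∈ (deletedJoin 2 (matroidM r)).faces := by
  obtain ⟨h1, h2, h3⟩ := mem_deletedJoin_matroidM.mp hs
  have hb : ∀ c' i e', e' ∈ block c' i (insert (c, j, e) s) →
      (c' = c ∧ i = j ∧ e' = e) ∨ e' ∈ block c' i s := by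
    intro c' i e' h
    simpa [mem_block] using h
  refine mem_deletedJoin_matroidM.mpr ⟨fun c' => ?_, fun c' i hi => ?_, fun c' c'' i hcc => ?_⟩
  · by_cases hcc : c' = c
    · subst hcc
      refine le_trans (Finset.card_le_card (t := insert (j, e) (slice c' s)) ?_)
        ((Finset.card_insert_le _ _).trans hc)
      rintro v hv
      simpa [mem_slice] using hv
    · refine le_trans (Finset.card_le_card ?_) (h1 c')
      rintro v hv
      simpa [mem_slice, hcc] using hv
  · by_cases hij : c' = c ∧ i = j
    · obtain ⟨rfl, rfl⟩ := hij
      have hemp := hj.resolve_left hi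
      refine le_trans (Finset.card_le_card (t := {e}) fun e' he' => ?_) (by simp)
      rcases hb _ _ _ he' with h | h
      · simp [h.2.2]
      · simp [hemp] at h
    · refine le_trans (Finset.card_le_card fun e' he' => ?_) (h2 c' i hi)
      rcases hb _ _ _ he' with h | h
      · exact absurd ⟨h.1, h.2.1⟩ hij
      · exact h
  · rw [Finset.disjoint_left]
    intro e' h h'
    rcases hb c' i e' h with ⟨k1, k2, k3⟩ | k
    · rcases hb c'' i e' h' with ⟨k1', -, -⟩ | k'
      · exact hcc (k1.trans k1'.symm)
      · exact he c'' (k2 ▸ k3 ▸ k')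
    · rcases hb c'' i e' h' with ⟨k1', k2', k3'⟩ | k'
      · exact he c' (k2' ▸ k3' ▸ k)
      · exact Finset.disjoint_left.mp (h3 c' c'' i hcc) k k'

theorem card_slice_erase_lt {r : ℕ} {s : Finset (Fin 2 × Fin r × Fin r)} {c : Fin 2}
    {v : Fin r × Fin r} (hv : (c, v) ∈ s) :
    (slice c (s.erase (c, v))).card < (slice c s).card := by
  refine Finset.card_lt_card (Finset.ssubset_iff_subset_ne.mpr ⟨fun w hw => ?_, fun h => ?_⟩)
  · exact mem_slice.mpr (Finset.mem_of_mem_erase (mem_slice.mp hw))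
  · have := mem_slice.mpr hv
    rw [← h, mem_slice] at this
    simp at this

/-- Moving an element inside one colour to a place that neither colour uses. -/
theorem move_mem {r : ℕ} {s : Finset (Fin 2 × Fin r × Fin r)}
    (hs : s ∈ (deletedJoin 2 (matroidM r)).faces) {c : Fin 2} {i x j y : Fin r}
    (hx : x ∈ block c i s) (hj : (j : ℕ) + 1 = r ∨ block c j s = ∅ ∨ j = i)
    (hy : ∀ c', y ∉ block c' j s) :
    insert (c, j, y) (s.erase (c, i, x)) ∈ (deletedJoin 2 (matroidM r)).faces := by
  obtain ⟨h1, h2, h3⟩ := mem_deletedJoin_matroidM.mp hs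
  have hsub := Finset.erase_subset (c, i, x) s
  refine insert_mem ((deletedJoin 2 (matroidM r)).down_closed hs hsub)
    ((card_slice_erase_lt (mem_block.mp hx)).trans_le (h1 c)) ?_
    fun c' h => hy c' (block_mono hsub h)
  by_cases hjr : (j : ℕ) + 1 = r
  · exact Or.inl hjr
  refine Or.inr (Finset.eq_empty_of_forall_notMem fun e he => ?_)
  rcases hj with h | h | rfl
  · exact hjr h
  · have := block_mono hsub he
    simp [h] at this
  · have := Finset.card_le_one.mp (h2 c j hjr) e (block_mono hsub he) x hx
    rw [mem_block, this] at he
    simp at he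

/-- The last block, the only one that may contain several elements of a colour. -/
def lastBlock {r : ℕ} (hr : 3 ≤ r) : Fin r := ⟨r - 1, by omega⟩

theorem ne_lastBlock_iff {r : ℕ} (hr : 3 ≤ r) {i : Fin r} :
    i ≠ lastBlock hr ↔ (i : ℕ) + 1 ≠ r := by
  rw [Ne, Fin.ext_iff]
  simp only [lastBlock]
  omega

theorem card_slice_eq_add {r : ℕ} (hr : 3 ≤ r) (c : Fin 2) (s : Finset (Fin 2 × Fin r × Fin r)) :
    (slice c s).card = (block c (lastBlock hr) s).card +
      ∑ i ∈ Finset.univ.erase (lastBlock hr), (block c i s).card := by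
  rw [card_slice_eq_sum_block]
  exact (Finset.add_sum_erase Finset.univ (fun i => (block c i s).card) (Finset.mem_univ _)).symm

theorem card_slice_le {r : ℕ} (hr : 3 ≤ r) {s : Finset (Fin 2 × Fin r × Fin r)}
    (hs : s ∈ (deletedJoin 2 (matroidM r)).faces) (c : Fin 2) :
    (slice c s).card ≤ (block c (lastBlock hr) s).card + (r - 1) := by
  have h2 := (mem_deletedJoin_matroidM.mp hs).2.1
  rw [card_slice_eq_add hr]
  have := Finset.sum_le_card_nsmul (Finset.univ.erase (lastBlock hr))
    (fun i => (block c i s).card) 1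
    (fun i hi => h2 c i ((ne_lastBlock_iff hr).mp (Finset.ne_of_mem_erase hi)))
  simp only [Finset.card_erase_of_mem (Finset.mem_univ _), Finset.card_univ, Fintype.card_fin,
    smul_eq_mul, mul_one] at this
  omega

theorem le_card_slice {r : ℕ} (hr : 3 ≤ r) {s : Finset (Fin 2 × Fin r × Fin r)} {c : Fin 2}
    (h : ∀ i, i ≠ lastBlock hr → block c i s ≠ ∅) :
    (block c (lastBlock hr) s).card + (r - 1) ≤ (slice c s).card := by
  rw [card_slice_eq_add hr]
  have := Finset.card_nsmul_le_sum (Finset.univ.erase (lastBlock hr))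
    (fun i => (block c i s).card) 1
    (fun i hi => Finset.card_pos.mpr
      (Finset.nonempty_iff_ne_empty.mpr (h i (Finset.ne_of_mem_erase hi))))
  simp only [Finset.card_erase_of_mem (Finset.mem_univ _), Finset.card_univ, Fintype.card_fin,
    smul_eq_mul, mul_one] at this
  omega

theorem exists_notMem_block {r : ℕ} (hr : 3 ≤ r) {s : Finset (Fin 2 × Fin r × Fin r)}
    (hs : s ∈ (deletedJoin 2 (matroidM r)).faces) {i : Fin r} (hi : i ≠ lastBlock hr) :
    ∃ e, ∀ c, e ∉ block c i s := by
  have h2 := fun c => (mem_deletedJoin_matroidM.mp hs).2.1 c i ((ne_lastBlock_iff hr).mp hi)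
  by_contra! h
  have hsub : (Finset.univ : Finset (Fin r)) ⊆ block 0 i s ∪ block 1 i s := by
    intro e _
    obtain ⟨c, hc⟩ := h e
    rw [Finset.mem_union]
    fin_cases c
    · exact Or.inl hc
    · exact Or.inr hc
  have h3 := (Finset.card_le_card hsub).trans (Finset.card_union_le _ _)
  have := h2 0
  have := h2 1
  simp only [Finset.card_univ, Fintype.card_fin] at h3
  omega

/-- In a facet, a colour with fewer than `r` elements meets every block but the last. -/
theorem block_ne_empty_of_isFacet {r : ℕ} (hr : 3 ≤ r) {F : Finset (Fin 2 × Fin r × Fin r)}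
    (hF : (deletedJoin 2 (matroidM r)).IsFacet F) {c : Fin 2} (hc : (slice c F).card < r)
    {i : Fin r} (hi : i ≠ lastBlock hr) : block c i F ≠ ∅ := by
  intro hemp
  obtain ⟨e, he⟩ := exists_notMem_block hr hF.1 hi
  have h := hF.2 (insert_mem hF.1 hc (Or.inr hemp) he) (Finset.subset_insert _ _)
  exact he c (mem_block.mpr (h (Finset.mem_insert_self _ _)))

/-- A facet either has `r` elements in each colour, or has a colour that fills the last block. -/
theorem facet_cases {r : ℕ} (hr : 3 ≤ r) {F : Finset (Fin 2 × Fin r × Fin r)}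
    (hF : (deletedJoin 2 (matroidM r)).IsFacet F) :
    (∀ c, (slice c F).card = r) ∨
      ∃ c c', c ≠ c' ∧ block c' (lastBlock hr) F = Finset.univ := by
  by_cases hall : ∀ c, (slice c F).card = r
  · exact Or.inl hall
  right
  push Not at hall
  obtain ⟨c, hc⟩ := hall
  have hc' : (slice c F).card < r := lt_of_le_of_ne ((mem_deletedJoin_matroidM.mp hF.1).1 c) hc
  have hle := le_card_slice hr (fun i hi => block_ne_empty_of_isFacet hr hF hc' hi)
  have hemp : block c (lastBlock hr) F = ∅ := Finset.card_eq_zero.mp (by omega)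
  obtain ⟨c', hcc⟩ := exists_ne c
  refine ⟨c, c', hcc.symm, Finset.eq_univ_of_forall fun e => ?_⟩
  by_contra he
  have hfree : ∀ d, e ∉ block d (lastBlock hr) F := by
    intro d
    by_cases hd : d = c
    · rw [hd, hemp]; simp
    · have : d = c' := by omega
      rwa [this]
  have hj : ((lastBlock hr : Fin r) : ℕ) + 1 = r := by simp only [lastBlock]; omega
  have h := hF.2 (insert_mem hF.1 hc' (Or.inl hj) hfree) (Finset.subset_insert _ _)
  exact hfree c (mem_block.mpr (h (Finset.mem_insert_self _ _)))

/-- If one colour fills the last block, then the other colour does not meet it, and the full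
colour meets no other block. -/
theorem block_eq_empty_of_full {r : ℕ} (hr : 3 ≤ r) {s : Finset (Fin 2 × Fin r × Fin r)}
    (hs : s ∈ (deletedJoin 2 (matroidM r)).faces) {c c' : Fin 2} (hcc : c ≠ c')
    (hfull : block c' (lastBlock hr) s = Finset.univ) :
    block c (lastBlock hr) s = ∅ ∧ ∀ i, i ≠ lastBlock hr → block c' i s = ∅ := by
  obtain ⟨h1, h2, h3⟩ := mem_deletedJoin_matroidM.mp hs
  refine ⟨?_, fun i hi => ?_⟩
  · have := h3 c c' (lastBlock hr) hcc
    rwa [hfull, ← Finset.top_eq_univ, disjoint_top] at this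
  · have h4 := h1 c'
    rw [card_slice_eq_add hr, hfull, Finset.card_univ, Fintype.card_fin] at h4
    have h5 : ∑ i ∈ Finset.univ.erase (lastBlock hr), (block c' i s).card = 0 := by omega
    exact Finset.card_eq_zero.mp
      (Finset.sum_eq_zero_iff.mp h5 i (Finset.mem_erase.mpr ⟨hi, Finset.mem_univ _⟩))

/-! ### The complex is not pure -/

/-- If one colour of a face `s` fills the last block, then one of its elements can be given to the
other colour, and compensated for in another block; this enlarges `s`. -/
theorem exists_larger_face_of_full {r : ℕ} (hr : 3 ≤ r) {s : Finset (Fin 2 × Fin r × Fin r)}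
    (hs : s ∈ (deletedJoin 2 (matroidM r)).faces) {c c' : Fin 2} (hcc : c ≠ c')
    (hfull : block c' (lastBlock hr) s = Finset.univ) (e : Fin r) :
    ∃ C ∈ (deletedJoin 2 (matroidM r)).faces, s.erase (c', lastBlock hr, e) ⊆ C ∧
      (c', lastBlock hr, e) ∉ C ∧ s.card < C.card := by
  obtain ⟨hemp, hemp'⟩ := block_eq_empty_of_full hr hs hcc hfull
  have hmem : (c', lastBlock hr, e) ∈ s := mem_block.mp (hfull ▸ Finset.mem_univ e)
  have hlast : ((lastBlock hr : Fin r) : ℕ) + 1 = r := by simp only [lastBlock]; omega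
  let i₀ : Fin r := ⟨0, by omega⟩
  have hi₀ : i₀ ≠ lastBlock hr := (ne_lastBlock_iff hr).mpr (by simp only [i₀]; omega)
  obtain ⟨z, hz⟩ := exists_notMem_block hr hs hi₀
  have hC₁ := move_mem hs (c := c') (j := i₀) (y := z) (mem_block.mpr hmem)
    (Or.inr (Or.inl (hemp' _ hi₀))) hz
  set C₁ := insert (c', i₀, z) (s.erase (c', lastBlock hr, e)) with hC₁def
  have hb : block c (lastBlock hr) C₁ = ∅ := by
    refine Finset.eq_empty_of_forall_notMem fun x hx => ?_
    have hx' : (c, lastBlock hr, x) ∈ s := by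
      rw [mem_block, hC₁def, Finset.mem_insert] at hx
      rcases hx with h | h
      · exact absurd (congrArg Prod.fst h) hcc
      · exact Finset.mem_of_mem_erase h
    rw [← mem_block, hemp] at hx'
    simp at hx'
  have hfree : ∀ d, e ∉ block d (lastBlock hr) C₁ := by
    intro d
    by_cases hd : d = c
    · rw [hd, hb]; simp
    · have : d = c' := by omega
      rw [this, mem_block, hC₁def]
      simp [hi₀.symm]
  have hlt : (slice c C₁).card < r := by
    have := card_slice_le hr hC₁ c
    rw [hb, Finset.card_empty] at this
    omega
  have hz' : (c', i₀, z) ∉ s.erase (c', lastBlock hr, e) := fun h =>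
    hz c' (mem_block.mpr (Finset.mem_of_mem_erase h))
  refine ⟨_, insert_mem hC₁ hlt (Or.inl hlast) hfree,
    (Finset.subset_insert _ _).trans (Finset.subset_insert _ _), ?_, ?_⟩
  · rw [Finset.mem_insert, not_or]
    refine ⟨fun h => hcc (congrArg Prod.fst h).symm, fun h => hfree c' (mem_block.mpr h)⟩
  · rw [Finset.card_insert_of_notMem fun h => hfree c (mem_block.mpr h), hC₁def,
      Finset.card_insert_of_notMem hz', Finset.card_erase_add_one hmem]
    omega

theorem not_isPure_deletedJoin_matroidM {r : ℕ} (hr : 3 ≤ r) :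
    ¬ (deletedJoin 2 (matroidM r)).IsPure := by
  intro hpure
  let s : Finset (Fin 2 × Fin r × Fin r) :=
    Finset.univ.image fun e => (1, lastBlock hr, e)
  have hmem : ∀ c i e, e ∈ block c i s ↔ c = 1 ∧ i = lastBlock hr := by
    intro c i e
    rw [mem_block, Finset.mem_image]
    constructor
    · rintro ⟨a, -, h⟩
      simp only [Prod.mk.injEq] at h
      exact ⟨h.1.symm, h.2.1.symm⟩
    · rintro ⟨rfl, rfl⟩
      exact ⟨e, Finset.mem_univ _, rfl⟩
  have hs : s ∈ (deletedJoin 2 (matroidM r)).faces := by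
    refine mem_deletedJoin_matroidM.mpr ⟨fun c => ?_, fun c i hi => ?_, fun c c' i hcc => ?_⟩
    · calc (slice c s).card ≤ s.card :=
            Finset.card_le_card_of_injOn (fun v => (c, v)) (fun v hv => mem_slice.mp hv)
              (fun a _ b _ h => (Prod.ext_iff.mp h).2)
        _ ≤ r := Finset.card_image_le.trans (by simp)
    · have : block c i s = ∅ := Finset.eq_empty_of_forall_notMem fun e he =>
        (ne_lastBlock_iff hr).mpr hi ((hmem c i e).mp he).2
      simp [this]
    · rw [Finset.disjoint_left]
      intro e he he'
      exact hcc (((hmem _ _ _).mp he).1.trans ((hmem _ _ _).mp he').1.symm)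
  obtain ⟨F, hsF, hF⟩ := exists_isFacet_superset _ hs
  have hfull : block 1 (lastBlock hr) F = Finset.univ := Finset.eq_univ_of_forall fun e =>
    block_mono hsF ((hmem _ _ _).mpr ⟨rfl, rfl⟩)
  obtain ⟨C, hC, -, -, hlt⟩ := exists_larger_face_of_full hr hF.1 (zero_ne_one) hfull ⟨0, by omega⟩
  obtain ⟨G, hCG, hG⟩ := exists_isFacet_superset _ hC
  have h1 := hpure F G hF hG
  have h2 := Finset.card_le_card hCG
  simp only [dim] at h1
  omega

/-! ### The key and the exchange of vertices -/

/-- Within a block, the first colour prefers small elements and the second colour prefers large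
ones; the elements of the first colour count more than those of the second. -/
def weight {r : ℕ} (v : Fin 2 × Fin r × Fin r) : ℕ :=
  if v.1 = 0 then (v.2.2 : ℕ) * r else r - 1 - v.2.2

/-- The key by which the facets are ordered: larger faces come first, then those that use blocks
with a smaller index, then those of smaller weight. -/
def key {r : ℕ} (s : Finset (Fin 2 × Fin r × Fin r)) : ℕ ×ₗ ℕ ×ₗ ℕ :=
  toLex (2 * r - s.card, toLex (∑ v ∈ s, (v.2.1 : ℕ), ∑ v ∈ s, weight v))

theorem key_lt_iff {r : ℕ} {s t : Finset (Fin 2 × Fin r × Fin r)} :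
    key s < key t ↔ 2 * r - s.card < 2 * r - t.card ∨ 2 * r - s.card = 2 * r - t.card ∧
      (∑ v ∈ s, (v.2.1 : ℕ) < ∑ v ∈ t, (v.2.1 : ℕ) ∨
        ∑ v ∈ s, (v.2.1 : ℕ) = ∑ v ∈ t, (v.2.1 : ℕ) ∧ ∑ v ∈ s, weight v < ∑ v ∈ t, weight v) := by
  simp only [key, Prod.Lex.toLex_lt_toLex]

theorem key_lt_of_card_lt {r : ℕ} {s t : Finset (Fin 2 × Fin r × Fin r)}
    (ht : t ∈ (deletedJoin 2 (matroidM r)).faces) (h : s.card < t.card) : key t < key s := by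
  have := card_le_of_mem ht
  exact key_lt_iff.mpr (Or.inl (by omega))

theorem sum_move {α : Type*} [DecidableEq α] {s : Finset α} {x y : α} (hx : x ∈ s) (hy : y ∉ s)
    (f : α → ℕ) : ∑ v ∈ insert y (s.erase x), f v + f x = ∑ v ∈ s, f v + f y := by
  rw [Finset.sum_insert fun h => hy (Finset.mem_of_mem_erase h), ← Finset.add_sum_erase s f hx]
  ring

theorem key_move_lt {r : ℕ} {s : Finset (Fin 2 × Fin r × Fin r)} {x y : Fin 2 × Fin r × Fin r}
    (hx : x ∈ s) (hy : y ∉ s) (h : y.2.1 < x.2.1 ∨ y.2.1 = x.2.1 ∧ weight y < weight x) :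
    key (insert y (s.erase x)) < key s := by
  have h1 := sum_move hx hy (fun _ => 1)
  have h2 := sum_move hx hy (fun v => (v.2.1 : ℕ))
  have h3 := sum_move hx hy weight
  simp only [Finset.sum_const, smul_eq_mul, mul_one] at h1
  refine key_lt_iff.mpr (Or.inr ⟨by omega, ?_⟩)
  rcases h with h | ⟨h, h'⟩
  · rw [Fin.lt_def] at h
    exact Or.inl (by omega)
  · rw [h] at h2
    exact Or.inr ⟨by omega, by omega⟩

/-- The conclusion demanded by `isShellable_of_exchange`: some vertex of `F \ G` can be traded so
as to reach a face with a smaller key. -/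
def CanExchange {r : ℕ} (F G : Finset (Fin 2 × Fin r × Fin r)) : Prop :=
  ∃ x ∈ F, x ∉ G ∧ ∃ C ∈ (deletedJoin 2 (matroidM r)).faces,
    F.erase x ⊆ C ∧ x ∉ C ∧ key C < key F

theorem canExchange_of_move {r : ℕ} {F G : Finset (Fin 2 × Fin r × Fin r)}
    (hF : F ∈ (deletedJoin 2 (matroidM r)).faces) {c : Fin 2} {i x j y : Fin r}
    (hx : x ∈ block c i F) (hxG : x ∉ block c i G)
    (hj : (j : ℕ) + 1 = r ∨ block c j F = ∅ ∨ j = i) (hy : ∀ c', y ∉ block c' j F)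
    (h : j < i ∨ j = i ∧ weight (c, j, y) < weight (c, i, x)) : CanExchange F G := by
  have hy' : (c, j, y) ∉ F := fun h => hy c (mem_block.mpr h)
  refine ⟨(c, i, x), mem_block.mp hx, fun h => hxG (mem_block.mpr h), _, move_mem hF hx hj hy,
    Finset.subset_insert _ _, ?_, key_move_lt (mem_block.mp hx) hy' h⟩
  rw [Finset.mem_insert, not_or]
  exact ⟨fun h => hy' (h ▸ mem_block.mp hx), Finset.notMem_erase _ _⟩

theorem sum_eq_sum_block {r : ℕ} (s : Finset (Fin 2 × Fin r × Fin r))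
    (f : Fin 2 × Fin r × Fin r → ℕ) :
    ∑ v ∈ s, f v = ∑ c, ∑ i, ∑ e ∈ block c i s, f (c, i, e) := by
  rw [sum_eq_sum_slice]
  exact Finset.sum_congr rfl fun c _ => sum_eq_sum_slice (slice c s) (fun w => f (c, w))

theorem sum_weight_eq {r : ℕ} (s : Finset (Fin 2 × Fin r × Fin r)) :
    ∑ v ∈ s, weight v =
      ∑ i, (∑ e ∈ block 0 i s, (e : ℕ) * r + ∑ e ∈ block 1 i s, (r - 1 - (e : ℕ))) := by
  rw [sum_eq_sum_block, Fin.sum_univ_two, ← Finset.sum_add_distrib]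
  rfl

theorem sum_index_eq {r : ℕ} (s : Finset (Fin 2 × Fin r × Fin r)) :
    ∑ v ∈ s, (v.2.1 : ℕ) = ∑ c, ∑ i : Fin r, (i : ℕ) * (block c i s).card := by
  rw [sum_eq_sum_block]
  simp [mul_comm]

/-- A colour whose elements are distributed differently over the blocks: move an element to a
block with a smaller index. -/
theorem canExchange_of_card_block_ne {r : ℕ} (hr : 3 ≤ r) {F G : Finset (Fin 2 × Fin r × Fin r)}
    (hF : F ∈ (deletedJoin 2 (matroidM r)).faces) (hG : G ∈ (deletedJoin 2 (matroidM r)).faces)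
    {c : Fin 2} (hcard : (slice c F).card = (slice c G).card)
    (hle : ∑ i : Fin r, (i : ℕ) * (block c i G).card ≤ ∑ i : Fin r, (i : ℕ) * (block c i F).card)
    (hne : (fun i => (block c i F).card) ≠ fun i => (block c i G).card) : CanExchange F G := by
  rw [card_slice_eq_sum_block, card_slice_eq_sum_block] at hcard
  obtain ⟨i, j, hji, hi, hj⟩ := exists_lt_of_sum_mul_le _ _ hcard hle hne
  obtain ⟨x, hxF, hxG⟩ := Finset.exists_mem_notMem_of_card_lt_card hi
  have hjl : (j : ℕ) + 1 ≠ r := by rw [Fin.lt_def] at hji; omega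
  have h1 := (mem_deletedJoin_matroidM.mp hG).2.1 c j hjl
  have hemp : block c j F = ∅ := Finset.card_eq_zero.mp (by omega)
  obtain ⟨y, hy⟩ := exists_notMem_block hr hF ((ne_lastBlock_iff hr).mpr hjl)
  exact canExchange_of_move hF hxF hxG (Or.inr (Or.inl hemp)) hy (Or.inl hji)

/-- Faces that use each block equally often, and that differ only in blocks in which each colour
has at most one element: exchange inside a block. -/
theorem canExchange_of_card_block_eq {r : ℕ} (hr : 3 ≤ r) {F G : Finset (Fin 2 × Fin r × Fin r)}
    (hF : F ∈ (deletedJoin 2 (matroidM r)).faces) (hG : G ∈ (deletedJoin 2 (matroidM r)).faces)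
    (hne : F ≠ G) (hcard : ∀ c i, (block c i F).card = (block c i G).card)
    (hlast : ∀ c, block c (lastBlock hr) F = block c (lastBlock hr) G ∨
      (block c (lastBlock hr) F).card ≤ 1)
    (hle : ∑ v ∈ G, weight v ≤ ∑ v ∈ F, weight v) : CanExchange F G := by
  obtain ⟨-, h2, h3⟩ := mem_deletedJoin_matroidM.mp hF
  have hsmall : ∀ c i, block c i F = block c i G ∨ (block c i F).card ≤ 1 := by
    intro c i
    by_cases hi : i = lastBlock hr
    · exact hi ▸ hlast c
    · exact Or.inr (h2 c i ((ne_lastBlock_iff hr).mp hi))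
  obtain ⟨i, hi, hile⟩ : ∃ i, ¬ (block 0 i F = block 0 i G ∧ block 1 i F = block 1 i G) ∧
      ∑ e ∈ block 0 i G, (e : ℕ) * r + ∑ e ∈ block 1 i G, (r - 1 - (e : ℕ)) ≤
        ∑ e ∈ block 0 i F, (e : ℕ) * r + ∑ e ∈ block 1 i F, (r - 1 - (e : ℕ)) := by
    by_contra! hcon
    obtain ⟨i, hi⟩ : ∃ i, ¬ (block 0 i F = block 0 i G ∧ block 1 i F = block 1 i G) := by
      by_contra! hall
      refine hne (Finset.ext ?_)
      rintro ⟨c, i, e⟩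
      rw [← mem_block, ← mem_block]
      fin_cases c
      · exact iff_of_eq (congrArg (e ∈ ·) (hall i).1)
      · exact iff_of_eq (congrArg (e ∈ ·) (hall i).2)
    rw [sum_weight_eq, sum_weight_eq] at hle
    refine absurd hle (not_le.mpr (Finset.sum_lt_sum (fun j _ => ?_)
      ⟨i, Finset.mem_univ _, hcon i fun h => fun h' => hi ⟨h, h'⟩⟩))
    by_cases hj : block 0 j F = block 0 j G ∧ block 1 j F = block 1 j G
    · rw [hj.1, hj.2]
    · exact (hcon j fun h => fun h' => hj ⟨h, h'⟩).le
  have hfree : ∀ y, y ∉ block 0 i F → y ∉ block 1 i F → ∀ c, y ∉ block c i F := by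
    intro y h0 h1 c
    fin_cases c
    · exact h0
    · exact h1
  rcases exists_block_exchange hr (h3 0 1 i zero_ne_one)
      ((mem_deletedJoin_matroidM.mp hG).2.2 0 1 i zero_ne_one) (hcard 0 i) (hcard 1 i)
      (hsmall 0 i) (hsmall 1 i) hi hile with
    ⟨x, hx, hxG, y, hy0, hy1, hlt⟩ | ⟨x, hx, hxG, y, hy0, hy1, hlt⟩
  · refine canExchange_of_move hF hx hxG (Or.inr (Or.inr rfl)) (hfree y hy0 hy1)
      (Or.inr ⟨rfl, ?_⟩)
    simp only [weight, if_true]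
    exact Nat.mul_lt_mul_of_pos_right hlt (by omega)
  · refine canExchange_of_move hF hx hxG (Or.inr (Or.inr rfl)) (hfree y hy0 hy1)
      (Or.inr ⟨rfl, ?_⟩)
    simp only [weight, one_ne_zero, if_false]
    rw [Fin.lt_def] at hlt
    omega

theorem canExchange_of_isFacet {r : ℕ} (hr : 3 ≤ r) {F G : Finset (Fin 2 × Fin r × Fin r)}
    (hF : (deletedJoin 2 (matroidM r)).IsFacet F) (hG : (deletedJoin 2 (matroidM r)).IsFacet G)
    (hne : F ≠ G) (hle : key G ≤ key F) : CanExchange F G := by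
  have hlex := mt key_lt_iff.mpr (not_lt.mpr hle)
  push Not at hlex
  obtain ⟨hc, hlex⟩ := hlex
  rcases facet_cases hr hF with hFr | ⟨c, c', hcc, hfull⟩
  · have hFc : F.card = 2 * r := by
      rw [card_eq_sum_card_slice, Fin.sum_univ_two, hFr, hFr]; ring
    have hGle := (mem_deletedJoin_matroidM.mp hG.1).1
    have hGc : 2 * r ≤ G.card := by
      have : 0 < 2 * r := by omega
      omega
    have hGr : ∀ c, (slice c G).card = r := by
      rw [card_eq_sum_card_slice, Fin.sum_univ_two] at hGc
      have h0 := hGle 0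
      have h1 := hGle 1
      intro c
      fin_cases c
      · change (slice 0 G).card = r; omega
      · change (slice 1 G).card = r; omega
    obtain ⟨hidx, hwt⟩ := hlex (by omega)
    by_cases hprof : ∀ c i, (block c i F).card = (block c i G).card
    · have hidx_eq : ∑ v ∈ F, (v.2.1 : ℕ) = ∑ v ∈ G, (v.2.1 : ℕ) := by
        rw [sum_index_eq, sum_index_eq]
        simp only [hprof]
      by_cases hlast : ∀ c, block c (lastBlock hr) F = block c (lastBlock hr) G ∨
          (block c (lastBlock hr) F).card ≤ 1
      · exact canExchange_of_card_block_eq hr hF.1 hG.1 hne hprof hlast (hwt hidx_eq)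
      -- Some colour has two elements in the last block, hence misses another block.
      push Not at hlast
      obtain ⟨c, hcne, hc1⟩ := hlast
      obtain ⟨x, hxF, hxG⟩ : ∃ x ∈ block c (lastBlock hr) F, x ∉ block c (lastBlock hr) G := by
        by_contra! hsub
        exact hcne (Finset.eq_of_subset_of_card_le hsub (hprof c _).ge)
      obtain ⟨j, hj, hjemp⟩ : ∃ j, j ≠ lastBlock hr ∧ block c j F = ∅ := by
        by_contra! hall
        have := le_card_slice hr (s := F) (c := c)
          fun i hi => Finset.nonempty_iff_ne_empty.mp (hall i hi)
        have := hFr c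
        omega
      obtain ⟨y, hy⟩ := exists_notMem_block hr hF.1 hj
      refine canExchange_of_move hF.1 hxF hxG (Or.inr (Or.inl hjemp)) hy (Or.inl ?_)
      have := (ne_lastBlock_iff hr).mp hj
      rw [Fin.lt_def]
      simp only [lastBlock]
      omega
    · obtain ⟨c, hcne, hcle⟩ : ∃ c, ((fun i => (block c i F).card) ≠ fun i => (block c i G).card) ∧
          ∑ i : Fin r, (i : ℕ) * (block c i G).card ≤
            ∑ i : Fin r, (i : ℕ) * (block c i F).card := by
        by_contra! hcon
        obtain ⟨c, hcne⟩ : ∃ c, (fun i => (block c i F).card) ≠ fun i => (block c i G).card := by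
          by_contra! hall
          exact hprof fun c i => congrFun (hall c) i
        rw [sum_index_eq, sum_index_eq] at hidx
        refine absurd hidx (not_le.mpr (Finset.sum_lt_sum (fun d _ => ?_)
          ⟨c, Finset.mem_univ _, hcon c hcne⟩))
        by_cases hd : (fun i => (block d i F).card) = fun i => (block d i G).card
        · exact (Finset.sum_congr rfl fun i _ => by rw [congrFun hd i]).le
        · exact (hcon d hd).le
      exact canExchange_of_card_block_ne hr hF.1 hG.1 ((hFr c).trans (hGr c).symm) hcle hcne
  · by_cases hGfull : block c' (lastBlock hr) G = Finset.univ
    · -- Both facets have the same full colour, and the other colour meets each block but the last.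
      obtain ⟨hFe, hFe'⟩ := block_eq_empty_of_full hr hF.1 hcc hfull
      obtain ⟨hGe, hGe'⟩ := block_eq_empty_of_full hr hG.1 hcc hGfull
      have hone : ∀ H : Finset (Fin 2 × Fin r × Fin r), (deletedJoin 2 (matroidM r)).IsFacet H →
          block c (lastBlock hr) H = ∅ → ∀ i, i ≠ lastBlock hr → (block c i H).card = 1 := by
        intro H hH hHe i hi
        have h1 := (mem_deletedJoin_matroidM.mp hH.1).2.1 c i ((ne_lastBlock_iff hr).mp hi)
        have h2 := card_slice_le hr hH.1 c
        rw [hHe, Finset.card_empty] at h2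
        have h3 := Finset.card_pos.mpr (Finset.nonempty_iff_ne_empty.mpr
          (block_ne_empty_of_isFacet hr hH (c := c) (by omega) hi))
        omega
      have hprof : ∀ d i, (block d i F).card = (block d i G).card := by
        intro d i
        by_cases hd : d = c
        · subst hd
          by_cases hi : i = lastBlock hr
          · rw [hi, hFe, hGe]
          · rw [hone F hF hFe i hi, hone G hG hGe i hi]
        · obtain rfl : d = c' := by omega
          by_cases hi : i = lastBlock hr
          · rw [hi, hfull, hGfull]
          · rw [hFe' i hi, hGe' i hi]
      have hlast : ∀ d, block d (lastBlock hr) F = block d (lastBlock hr) G ∨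
          (block d (lastBlock hr) F).card ≤ 1 := by
        intro d
        by_cases hd : d = c
        · subst hd
          exact Or.inl (hFe.trans hGe.symm)
        · obtain rfl : d = c' := by omega
          exact Or.inl (hfull.trans hGfull.symm)
      have hcardeq : F.card = G.card := by
        rw [card_eq_sum_card_slice, card_eq_sum_card_slice]
        simp only [card_slice_eq_sum_block, hprof]
      have hidx_eq : ∑ v ∈ F, (v.2.1 : ℕ) = ∑ v ∈ G, (v.2.1 : ℕ) := by
        rw [sum_index_eq, sum_index_eq]
        simp only [hprof]
      exact canExchange_of_card_block_eq hr hF.1 hG.1 hne hprof hlast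
        ((hlex (by rw [hcardeq])).2 hidx_eq)
    · obtain ⟨e, he⟩ : ∃ e, e ∉ block c' (lastBlock hr) G := by
        by_contra! h
        exact hGfull (Finset.eq_univ_of_forall h)
      obtain ⟨C, hC, hsub, hmem, hlt⟩ := exists_larger_face_of_full hr hF.1 hcc hfull e
      exact ⟨(c', lastBlock hr, e), mem_block.mp (hfull ▸ Finset.mem_univ e),
        fun h => he (mem_block.mpr h), C, hC, hsub, hmem, key_lt_of_card_lt hC hlt⟩

end AbsComplex

theorem mainTheorem4 (r : ℕ) (hr : 3 ≤ r) :
    ¬ (AbsComplex.deletedJoin 2 (AbsComplex.matroidM r)).IsPure ∧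
      (AbsComplex.deletedJoin 2 (AbsComplex.matroidM r)).IsShellable :=
  ⟨AbsComplex.not_isPure_deletedJoin_matroidM hr,
    AbsComplex.isShellable_of_exchange _ AbsComplex.key
      (fun _ _ ht hst => AbsComplex.key_lt_of_card_lt ht (Finset.card_lt_card hst))
      fun _ _ => AbsComplex.canExchange_of_isFacet hr⟩
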